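/- For an integer $d\ge 0$, let $gl_d$ be the complex Lie algebra of $d\times d$ matrices with elementary matrices $E_{ij}$. A generalized partition of length $d$ is a non-increasing sequence $\lambda=(\lambda_1,\dots,\lambda_d)$ of integers; it is a partition if all $\lambda_i\ge 0$, and it is non-positive if all $\lambda_i\le 0$. For a generalized partition $\lambda$ of length $d$, let $V_d^\lambda$ be the irreducible $gl_d$-module with highest weight $\lambda$ relative to the Borel subalgebra of upper triangular matrices (generated by a nonzero vector $v$ with $E_{ij}v=0$ for $i<j$ and $E_{ii}v=\lambda_i v$). For generalized partitions $\lambda,\mu,\nu$ of length $d$, the Littlewood--Richardson coefficient $C_{\lambda\mu}^{\nu}$ is the multiplicity $\dim_{\mathbb C}\operatorname{Hom}_{gl_d}(V_d^\nu,\,V_d^\lambda\otimes V_d^\mu)$ of $V_d^\nu$ in $V_d^\lambda\otimes V_d^\mu$. Let $\lambda$ be a partition of length $d$, let $\mu$ be a non-positive generalized partition of length $d$, and let $\nu$ be a generalized partition of length $d$. If $\nu_m>\lambda_m$ or $\nu_m<\mu_m$ for some $m\in\{1,2,\dots,d\}$, then $C_{\lambda\mu}^{\nu}=0$. -/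

import Mathlib

open scoped TensorProduct

attribute [local instance 100] LieRing.ofAssociativeRing

/-- A generalized partition of length `d`: a non-increasing sequence of `d` integers. -/
def IsGeneralizedPartition {d : ℕ} (lam : Fin d → ℤ) : Prop := Antitone lam

/-- A partition of length `d`: a non-increasing sequence of `d` non-negative integers. -/
def IsPartition {d : ℕ} (lam : Fin d → ℤ) : Prop := Antitone lam ∧ ∀ i, 0 ≤ lam i

/-- A generalized partition of length `d` all of whose entries are non-positive. -/
def IsNonposGeneralizedPartition {d : ℕ} (mu : Fin d → ℤ) : Prop := Antitone mu ∧ ∀ i, mu i ≤ 0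

/-- The complex Lie algebra `gl_d` of all `d × d` matrices, with the commutator bracket. -/
abbrev Gl (d : ℕ) : Type := Matrix (Fin d) (Fin d) ℂ

/-- The universal enveloping algebra `U(gl_d)`. -/
abbrev UGl (d : ℕ) : Type := UniversalEnvelopingAlgebra ℂ (Gl d)

/-- The elementary matrix `E_{ij}`, viewed in `U(gl_d)`. -/
noncomputable def uE (d : ℕ) (i j : Fin d) : UGl d :=
  UniversalEnvelopingAlgebra.ι ℂ (Matrix.single i j (1 : ℂ) : Gl d)

/-- The left ideal of `U(gl_d)` generated by the `E_{ij}` with `i < j` and the `E_{ii} - lam_i`. -/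
noncomputable def vermaIdeal (d : ℕ) (lam : Fin d → ℂ) : Submodule (UGl d) (UGl d) :=
  Submodule.span (UGl d)
    ({x | ∃ i j : Fin d, i < j ∧ x = uE d i j} ∪
      {x | ∃ i : Fin d, x = uE d i i - algebraMap ℂ (UGl d) (lam i)})

/-- The Verma module of highest weight `lam` relative to the Borel subalgebra of upper triangular
matrices. -/
abbrev VermaModule (d : ℕ) (lam : Fin d → ℂ) : Type := UGl d ⧸ vermaIdeal d lam

/-- The largest proper submodule of the Verma module: the sum of all its proper submodules (which
is proper, since none of them meets the one-dimensional weight space of weight `lam`). -/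
noncomputable def vermaRadical (d : ℕ) (lam : Fin d → ℂ) :
    Submodule (UGl d) (VermaModule d lam) :=
  sSup {N | N ≠ ⊤}

/-- The irreducible `gl_d`-module `V_d^lam` with highest weight `lam` relative to the standard
Borel subalgebra: the quotient of the Verma module by its largest proper submodule. -/
def IrrepGl (d : ℕ) (lam : Fin d → ℂ) : Type := VermaModule d lam ⧸ vermaRadical d lam

noncomputable instance (d : ℕ) (lam : Fin d → ℂ) : AddCommGroup (IrrepGl d lam) :=
  inferInstanceAs (AddCommGroup (VermaModule d lam ⧸ vermaRadical d lam))

noncomputable instance (d : ℕ) (lam : Fin d → ℂ) : Module (UGl d) (IrrepGl d lam) :=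
  inferInstanceAs (Module (UGl d) (VermaModule d lam ⧸ vermaRadical d lam))

noncomputable instance (d : ℕ) (lam : Fin d → ℂ) : Module ℂ (IrrepGl d lam) :=
  inferInstanceAs (Module ℂ (VermaModule d lam ⧸ vermaRadical d lam))

instance (d : ℕ) (lam : Fin d → ℂ) : IsScalarTower ℂ (UGl d) (IrrepGl d lam) :=
  inferInstanceAs (IsScalarTower ℂ (UGl d) (VermaModule d lam ⧸ vermaRadical d lam))

/-- A matrix `x` acts on `IrrepGl d lam` as its image in `U(gl_d)` does. -/
noncomputable instance (d : ℕ) (lam : Fin d → ℂ) : LieRingModule (Gl d) (IrrepGl d lam) where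
  bracket x v := UniversalEnvelopingAlgebra.ι ℂ x • v
  add_lie x y v := by
    show UniversalEnvelopingAlgebra.ι ℂ (x + y) • v = _
    rw [map_add, add_smul]
  lie_add x v w := smul_add _ v w
  leibniz_lie x y v := by
    show UniversalEnvelopingAlgebra.ι ℂ x • UniversalEnvelopingAlgebra.ι ℂ y • v =
      UniversalEnvelopingAlgebra.ι ℂ ⁅x, y⁆ • v +
        UniversalEnvelopingAlgebra.ι ℂ y • UniversalEnvelopingAlgebra.ι ℂ x • v
    rw [LieHom.map_lie, LieRing.of_associative_ring_bracket, sub_smul, mul_smul, mul_smul]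
    abel

instance (d : ℕ) (lam : Fin d → ℂ) : LieModule ℂ (Gl d) (IrrepGl d lam) where
  smul_lie c x v := by
    show UniversalEnvelopingAlgebra.ι ℂ (c • x) • v = c • (UniversalEnvelopingAlgebra.ι ℂ x • v)
    rw [map_smul, smul_assoc]
  lie_smul c x v := by
    show UniversalEnvelopingAlgebra.ι ℂ x • (c • v) = c • (UniversalEnvelopingAlgebra.ι ℂ x • v)
    rw [← algebraMap_smul (UGl d) c v,
      ← algebraMap_smul (UGl d) c (UniversalEnvelopingAlgebra.ι ℂ x • v), smul_smul, smul_smul,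
      Algebra.commutes]

/-- The Littlewood-Richardson coefficient `C_{lam mu}^nu` for `gl_d`: the multiplicity of
`V_d^nu` in `V_d^lam ⊗ V_d^mu`, that is, the dimension of the space of `gl_d`-homomorphisms
from `V_d^nu` to `V_d^lam ⊗ V_d^mu`. -/
noncomputable def lrCoeff (d : ℕ) (lam mu nu : Fin d → ℤ) : ℕ∞ :=
  Cardinal.toENat (Module.rank ℂ
    (IrrepGl d (fun i => (nu i : ℂ)) →ₗ⁅ℂ, Gl d⁆
      (IrrepGl d (fun i => (lam i : ℂ)) ⊗[ℂ] IrrepGl d (fun i => (mu i : ℂ)))))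

/-!
If `V_d^nu` occurs in `V_d^lam ⊗ V_d^mu`, the image of its highest weight vector is a nonzero
vector `w` of weight `nu` killed by the `E_{ij}` with `i < j`. The component of `w` along the
highest weight vector of `V_d^lam` is nonzero and has weight `nu - lam` in `V_d^mu`
(`exists_weight_vector_of_tensor`). As `mu` is non-positive, all weights of `V_d^mu` have
non-positive entries, so `nu ≤ lam`. Exchanging the factors, `nu - mu` is a weight of `V_d^lam`,
whose weights have non-negative entries, so `mu ≤ nu`.

The component of `w` is taken with a functional `f` on `V_d^lam` invariant under strictly lower
triangular matrices (`exists_lowest_functional`), obtained by grading `V_d^lam` by height. If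
contracting `w` with `f` gave zero, then, `w` being a highest weight vector and `f` a lowest weight
vector, so would contracting with every `U(gl_d)`-translate of `f`, by the decomposition
`U(g) = n⁻ U(g) + U(b⁺)` (`UGl.eq_top_of_lower_mul_mem`); by irreducibility these translates
separate the points of `V_d^lam`, whence `w = 0`.

For the signs of the weights, `gl_d` acts on the polynomials in a `d × d` matrix of variables by
polarization operators. There every monomial is a weight vector with non-negative weight, and the
products of leading principal minors are highest weight vectors realizing every partition
(`IsPartition.exists_highest_weight_polynomial`). Since `V_d^lam` is a quotient of the submodule
generated by such a vector, its weights are non-negative too. For a non-positive `mu` the action is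
twisted by the automorphism `E_{ij} ↦ -E_{d+1-j, d+1-i}`.
-/

/-! ### Words in the enveloping algebra -/

open UniversalEnvelopingAlgebra in
theorem adjoin_range_ι_eq_top (d : ℕ) :
    Algebra.adjoin ℂ (Set.range (ι ℂ : Gl d → UGl d)) = ⊤ := by
  set S := Algebra.adjoin ℂ (Set.range (ι ℂ : Gl d → UGl d))
  -- the universal property gives a retraction onto `S`, which must be the identity
  let g : Gl d →ₗ⁅ℂ⁆ S :=
    { toFun := fun x => ⟨ι ℂ x, Algebra.subset_adjoin ⟨x, rfl⟩⟩
      map_add' := fun x y => Subtype.ext (map_add (ι ℂ) x y)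
      map_smul' := fun c x => Subtype.ext (map_smul (ι ℂ) c x)
      map_lie' := fun {x y} => Subtype.ext (LieHom.map_lie (ι ℂ) x y) }
  have h : S.val.comp (lift ℂ g) = AlgHom.id ℂ (UGl d) := by
    apply hom_ext
    ext x : 1
    change ((lift ℂ g (ι ℂ x) : S) : UGl d) = ι ℂ x
    rw [lift_ι_apply]
    rfl
  refine Algebra.eq_top_iff.2 fun u => ?_
  have hu := congrArg (fun F : UGl d →ₐ[ℂ] UGl d => F u) h
  change ((lift ℂ g u : S) : UGl d) = u at hu
  rw [← hu]
  exact (lift ℂ g u).2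

theorem ι_eq_sum_uE {d : ℕ} (x : Gl d) :
    UniversalEnvelopingAlgebra.ι ℂ x = ∑ i, ∑ j, x i j • uE d i j := by
  conv_lhs => rw [Matrix.matrix_eq_sum_single x]
  simp only [map_sum, uE, ← map_smul, Matrix.smul_single, smul_eq_mul, mul_one]

theorem span_closure_uE_eq_top (d : ℕ) :
    Submodule.span ℂ (Submonoid.closure
      (Set.range fun p : Fin d × Fin d => uE d p.1 p.2) : Set (UGl d)) = ⊤ := by
  rw [← Algebra.adjoin_eq_span, ← Algebra.top_toSubmodule]
  congr 1
  rw [eq_top_iff, ← adjoin_range_ι_eq_top, Algebra.adjoin_le_iff]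
  rintro _ ⟨x, rfl⟩
  rw [ι_eq_sum_uE]
  exact Subalgebra.sum_mem _ fun i _ => Subalgebra.sum_mem _ fun j _ =>
    Subalgebra.smul_mem _ (Algebra.subset_adjoin (Set.mem_range_self (i, j))) _

theorem UGl.eq_top_of_mul_left_mem {d : ℕ} (Z : Submodule ℂ (UGl d)) (h1 : 1 ∈ Z)
    (hZ : ∀ i j, ∀ u ∈ Z, uE d i j * u ∈ Z) : Z = ⊤ := by
  rw [eq_top_iff, ← span_closure_uE_eq_top, Submodule.span_le]
  intro u hu
  induction hu using Submonoid.closure_induction_left with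
  | one => exact h1
  | mul_left x hx y hy ih =>
    obtain ⟨p, rfl⟩ := hx
    exact hZ _ _ _ ih

theorem uE_mul_uE (d : ℕ) (i j k l : Fin d) :
    uE d i j * uE d k l = uE d k l * uE d i j +
      ((if j = k then uE d i l else 0) - (if l = i then uE d k j else 0)) := by
  have h := LieHom.map_lie (UniversalEnvelopingAlgebra.ι ℂ)
    (Matrix.single i j (1 : ℂ) : Gl d) (Matrix.single k l (1 : ℂ) : Gl d)
  rw [LieRing.of_associative_ring_bracket, LieRing.of_associative_ring_bracket, map_sub] at h
  have aux : ∀ a b c e : Fin d, UniversalEnvelopingAlgebra.ι ℂ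
      ((Matrix.single a b (1 : ℂ) : Gl d) * (Matrix.single c e (1 : ℂ) : Gl d)) =
      if b = c then uE d a e else 0 := by
    intro a b c e
    split_ifs with hbc
    · subst hbc
      rw [Matrix.single_mul_single_same, mul_one, uE]
    · rw [Matrix.single_mul_single_of_ne _ _ _ _ hbc, map_zero]
  rw [aux, aux] at h
  rw [h]
  simp only [uE]
  abel

/-- The decomposition `U(g) = n⁻ U(g) + U(b⁺)`, in the form of an induction principle. -/
theorem UGl.eq_top_of_lower_mul_mem {d : ℕ} (Z : Submodule ℂ (UGl d)) (h1 : 1 ∈ Z)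
    (hlow : ∀ i j, j < i → ∀ u, uE d i j * u ∈ Z)
    (hup : ∀ i j, i ≤ j → ∀ u ∈ Z, u * uE d i j ∈ Z) : Z = ⊤ := by
  rw [eq_top_iff, ← span_closure_uE_eq_top, Submodule.span_le]
  intro u hu
  induction hu using Submonoid.closure_induction_right generalizing Z with
  | one => exact h1
  | mul_right x hx y hy ih =>
    obtain ⟨⟨a, b⟩, rfl⟩ := hy
    -- the elements of `Z` that the generators multiply into `Z` satisfy the same hypotheses
    let W : Submodule ℂ (UGl d) :=
      { carrier := {z | z ∈ Z ∧ ∀ i j, z * uE d i j ∈ Z}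
        zero_mem' := ⟨Z.zero_mem, fun i j => by rw [zero_mul]; exact Z.zero_mem⟩
        add_mem' := fun h h' => ⟨Z.add_mem h.1 h'.1, fun i j => by
          rw [add_mul]; exact Z.add_mem (h.2 i j) (h'.2 i j)⟩
        smul_mem' := fun c z h => ⟨Z.smul_mem c h.1, fun i j => by
          rw [smul_mul_assoc]; exact Z.smul_mem c (h.2 i j)⟩ }
    have hW : x ∈ W := by
      refine ih W ⟨h1, fun i j => ?_⟩ (fun i j hij u => ⟨hlow i j hij u, fun k l => ?_⟩)
        (fun i j hij u hu => ⟨hup i j hij u hu.1, fun k l => ?_⟩)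
      · rcases lt_or_ge j i with hij | hij
        · simpa using hlow i j hij 1
        · exact hup i j hij 1 h1
      · rw [mul_assoc]
        exact hlow i j hij _
      · rw [mul_assoc, uE_mul_uE, mul_add, mul_sub, ← mul_assoc]
        refine Z.add_mem (hup i j hij _ (hu.2 k l)) (Z.sub_mem ?_ ?_)
        · split_ifs
          · exact hu.2 _ _
          · rw [mul_zero]; exact Z.zero_mem
        · split_ifs
          · exact hu.2 _ _
          · rw [mul_zero]; exact Z.zero_mem
    exact hW.2 a b

/-- The decomposition `U(g) = U(b⁻) + U(g) n⁺`, in the form of an induction principle. -/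
theorem UGl.eq_top_of_mul_upper_mem {d : ℕ} (Z : Submodule ℂ (UGl d)) (h1 : 1 ∈ Z)
    (hup : ∀ i j, i < j → ∀ u, u * uE d i j ∈ Z)
    (hlow : ∀ i j, j ≤ i → ∀ u ∈ Z, uE d i j * u ∈ Z) : Z = ⊤ := by
  rw [eq_top_iff, ← span_closure_uE_eq_top, Submodule.span_le]
  intro u hu
  induction hu using Submonoid.closure_induction_left generalizing Z with
  | one => exact h1
  | mul_left x hx y hy ih =>
    obtain ⟨⟨a, b⟩, rfl⟩ := hx
    -- as above, with the generators now acting on the left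
    let W : Submodule ℂ (UGl d) :=
      { carrier := {z | z ∈ Z ∧ ∀ i j, uE d i j * z ∈ Z}
        zero_mem' := ⟨Z.zero_mem, fun i j => by rw [mul_zero]; exact Z.zero_mem⟩
        add_mem' := fun h h' => ⟨Z.add_mem h.1 h'.1, fun i j => by
          rw [mul_add]; exact Z.add_mem (h.2 i j) (h'.2 i j)⟩
        smul_mem' := fun c z h => ⟨Z.smul_mem c h.1, fun i j => by
          rw [mul_smul_comm]; exact Z.smul_mem c (h.2 i j)⟩ }
    have hW : y ∈ W := by
      refine ih W ⟨h1, fun i j => ?_⟩ (fun i j hij u => ⟨hup i j hij u, fun k l => ?_⟩)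
        (fun i j hij u hu => ⟨hlow i j hij u hu.1, fun k l => ?_⟩)
      · rcases lt_or_ge i j with hij | hij
        · simpa using hup i j hij 1
        · exact hlow i j hij 1 h1
      · rw [← mul_assoc]
        exact hup i j hij _
      · rw [← mul_assoc, uE_mul_uE, add_mul, sub_mul, mul_assoc]
        refine Z.add_mem (hlow i j hij _ (hu.2 k l)) (Z.sub_mem ?_ ?_)
        · split_ifs
          · exact hu.2 _ _
          · rw [zero_mul]; exact Z.zero_mem
        · split_ifs
          · exact hu.2 _ _
          · rw [zero_mul]; exact Z.zero_mem
    exact hW.2 a b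

/-! ### The highest weight vector and irreducibility -/

/-- The quotient map from the Verma module onto `V_d^lam`. -/
noncomputable def vermaToIrrep (d : ℕ) (lam : Fin d → ℂ) :
    VermaModule d lam →ₗ[UGl d] IrrepGl d lam :=
  (vermaRadical d lam).mkQ

theorem vermaToIrrep_surjective (d : ℕ) (lam : Fin d → ℂ) :
    Function.Surjective (vermaToIrrep d lam) :=
  Submodule.mkQ_surjective (vermaRadical d lam)

/-- The canonical surjection `U(gl_d) → V_d^lam`, sending `1` to the highest weight vector. -/
noncomputable def irrepMk (d : ℕ) (lam : Fin d → ℂ) : UGl d →ₗ[UGl d] IrrepGl d lam :=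
  vermaToIrrep d lam ∘ₗ (vermaIdeal d lam).mkQ

/-- The highest weight vector of `V_d^lam`. -/
noncomputable def hwVector (d : ℕ) (lam : Fin d → ℂ) : IrrepGl d lam := irrepMk d lam 1

theorem irrepMk_eq_smul {d : ℕ} (lam : Fin d → ℂ) (u : UGl d) :
    irrepMk d lam u = u • hwVector d lam := by
  rw [hwVector, ← map_smul, smul_eq_mul, mul_one]

theorem exists_smul_hwVector {d : ℕ} {lam : Fin d → ℂ} (x : IrrepGl d lam) :
    ∃ u : UGl d, u • hwVector d lam = x := by
  obtain ⟨y, rfl⟩ := vermaToIrrep_surjective d lam x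
  obtain ⟨u, rfl⟩ := Submodule.mkQ_surjective (vermaIdeal d lam) y
  exact ⟨u, (irrepMk_eq_smul lam u).symm⟩

theorem irrepMk_eq_zero_of_mem {d : ℕ} {lam : Fin d → ℂ} {u : UGl d}
    (hu : u ∈ vermaIdeal d lam) : irrepMk d lam u = 0 := by
  have : (vermaIdeal d lam).mkQ u = 0 := by simpa using hu
  rw [irrepMk, LinearMap.comp_apply, this, map_zero]

theorem uE_smul_hwVector_of_lt {d : ℕ} (lam : Fin d → ℂ) {i j : Fin d} (hij : i < j) :
    uE d i j • hwVector d lam = 0 := by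
  rw [← irrepMk_eq_smul]
  exact irrepMk_eq_zero_of_mem (Submodule.subset_span (Or.inl ⟨i, j, hij, rfl⟩))

theorem uE_self_smul_hwVector {d : ℕ} (lam : Fin d → ℂ) (i : Fin d) :
    uE d i i • hwVector d lam = lam i • hwVector d lam := by
  have h := irrepMk_eq_zero_of_mem (lam := lam)
    (Submodule.subset_span (Or.inr ⟨i, rfl⟩) :
      uE d i i - algebraMap ℂ (UGl d) (lam i) ∈ vermaIdeal d lam)
  rwa [irrepMk_eq_smul, sub_smul, algebraMap_smul, sub_eq_zero] at h

/-- By definition `vermaRadical` contains every proper submodule of the Verma module. -/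
theorem vermaToIrrep_eq_zero_of_mem {d : ℕ} {lam : Fin d → ℂ}
    {N : Submodule (UGl d) (VermaModule d lam)} (hN : N ≠ ⊤) {x : VermaModule d lam}
    (hx : x ∈ N) : vermaToIrrep d lam x = 0 := by
  have : N ≤ vermaRadical d lam := le_sSup hN
  exact (Submodule.Quotient.mk_eq_zero _).2 (this hx)

theorem IrrepGl.eq_bot_of_ne_top {d : ℕ} {lam : Fin d → ℂ}
    (N : Submodule (UGl d) (IrrepGl d lam)) (hN : N ≠ ⊤) : N = ⊥ := by
  have hπ := vermaToIrrep_surjective d lam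
  have hc : N.comap (vermaToIrrep d lam) ≠ ⊤ := fun h => hN <| by
    rw [← Submodule.map_comap_eq_of_surjective hπ N, h, Submodule.map_top,
      LinearMap.range_eq_top.2 hπ]
  rw [Submodule.eq_bot_iff]
  intro x hx
  obtain ⟨y, rfl⟩ := hπ x
  exact vermaToIrrep_eq_zero_of_mem hc hx

/-! ### The projection to the highest weight space -/

/-- The element `-∑ i E_{ii}` of the Cartan subalgebra, whose eigenvalues grade a module by
height: `E_{ij}` shifts them by `j - i`. -/
noncomputable def gradingElement (d : ℕ) : UGl d := ∑ k : Fin d, (-(k : ℂ)) • uE d k k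

theorem gradingElement_mul_uE (d : ℕ) (i j : Fin d) :
    gradingElement d * uE d i j =
      uE d i j * gradingElement d + ((j : ℂ) - (i : ℂ)) • uE d i j := by
  simp only [gradingElement, Finset.sum_mul, Finset.mul_sum, smul_mul_assoc, mul_smul_comm]
  have : ∀ k : Fin d, (-(k : ℂ)) • (uE d k k * uE d i j) = (-(k : ℂ)) • (uE d i j * uE d k k) +
      ((if k = i then (-(k : ℂ)) • uE d k j else 0) -
        (if j = k then (-(k : ℂ)) • uE d i k else 0)) := by
    intro k
    rw [uE_mul_uE]
    split_ifs <;> simp [sub_eq_add_neg, smul_add]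
  simp only [this, Finset.sum_add_distrib, Finset.sum_sub_distrib, Finset.sum_ite_eq,
    Finset.sum_ite_eq', Finset.mem_univ, if_true]
  rw [sub_smul, neg_smul, neg_smul]
  abel

/-- The action of an element of `U(gl_d)` on `V_d^lam` as a complex-linear map. -/
noncomputable abbrev actU {d : ℕ} {lam : Fin d → ℂ} (u : UGl d) :
    IrrepGl d lam →ₗ[ℂ] IrrepGl d lam :=
  Algebra.lsmul ℂ ℂ (IrrepGl d lam) u

/-- The eigenvalue of `gradingElement` on the highest weight vector. -/
noncomputable def hwGrade {d : ℕ} (lam : Fin d → ℂ) : ℂ := ∑ k : Fin d, -(k : ℂ) * lam k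

/-- The sum of the eigenspaces of `gradingElement` lying strictly below the highest weight. -/
noncomputable def lowerPart (d : ℕ) (lam : Fin d → ℂ) : Submodule ℂ (IrrepGl d lam) :=
  ⨆ n : ℕ, Module.End.eigenspace (actU (lam := lam) (gradingElement d)) (hwGrade lam - (n + 1))

theorem gradingElement_smul_hwVector {d : ℕ} (lam : Fin d → ℂ) :
    gradingElement d • hwVector d lam = hwGrade lam • hwVector d lam := by
  rw [gradingElement, hwGrade, Finset.sum_smul, Finset.sum_smul]
  refine Finset.sum_congr rfl fun k _ => ?_
  rw [smul_assoc, uE_self_smul_hwVector, smul_smul]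

theorem gradingElement_smul_uE_smul {d : ℕ} {lam : Fin d → ℂ} {x : IrrepGl d lam} {c : ℂ}
    (hx : gradingElement d • x = c • x) (i j : Fin d) :
    gradingElement d • uE d i j • x = (c + ((j : ℂ) - (i : ℂ))) • uE d i j • x := by
  rw [smul_smul, gradingElement_mul_uE, add_smul, mul_smul, hx, smul_assoc, add_smul,
    smul_comm (uE d i j) c x]

theorem uE_smul_hwVector_mem_lowerPart {d : ℕ} (lam : Fin d → ℂ) {i j : Fin d} (hij : j < i) :
    uE d i j • hwVector d lam ∈ lowerPart d lam := by
  obtain ⟨n, hn⟩ := Nat.exists_eq_add_of_lt (Fin.lt_def.1 hij)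
  refine Submodule.mem_iSup_of_mem n (Module.End.mem_eigenspace_iff.2 ?_)
  refine (gradingElement_smul_uE_smul (gradingElement_smul_hwVector lam) i j).trans ?_
  rw [hn]
  push_cast
  congr 1
  ring

theorem uE_smul_mem_lowerPart {d : ℕ} {lam : Fin d → ℂ} {i j : Fin d} (hij : j ≤ i)
    {x : IrrepGl d lam} (hx : x ∈ lowerPart d lam) : uE d i j • x ∈ lowerPart d lam := by
  obtain ⟨n, hn⟩ := Nat.exists_eq_add_of_le (Fin.le_def.1 hij)
  suffices h : lowerPart d lam ≤ (lowerPart d lam).comap (actU (uE d i j)) from h hx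
  refine iSup_le fun m y hy => ?_
  refine Submodule.mem_iSup_of_mem (m + n) (Module.End.mem_eigenspace_iff.2 ?_)
  refine (gradingElement_smul_uE_smul (Module.End.mem_eigenspace_iff.1 hy) i j).trans ?_
  rw [hn]
  push_cast
  congr 1
  ring

theorem span_hwVector_sup_lowerPart (d : ℕ) (lam : Fin d → ℂ) :
    Submodule.span ℂ {hwVector d lam} ⊔ lowerPart d lam = ⊤ := by
  set T := Submodule.span ℂ {hwVector d lam} ⊔ lowerPart d lam
  have hv : hwVector d lam ∈ T :=
    Submodule.mem_sup_left (Submodule.mem_span_singleton_self _)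
  let Z : Submodule ℂ (UGl d) :=
    { carrier := {u | u • hwVector d lam ∈ T}
      zero_mem' := by
        change (0 : UGl d) • hwVector d lam ∈ T
        rw [zero_smul]; exact T.zero_mem
      add_mem' := fun {a b} ha hb => by
        change (a + b) • hwVector d lam ∈ T
        rw [add_smul]; exact T.add_mem ha hb
      smul_mem' := fun c a ha => by
        change (c • a) • hwVector d lam ∈ T
        rw [smul_assoc]; exact T.smul_mem c ha }
  have hZ : Z = ⊤ := by
    refine UGl.eq_top_of_mul_upper_mem Z ?_ (fun i j hij u => ?_) (fun i j hij u hu => ?_)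
    · change (1 : UGl d) • hwVector d lam ∈ T
      rwa [one_smul]
    · change (u * uE d i j) • hwVector d lam ∈ T
      rw [mul_smul, uE_smul_hwVector_of_lt lam hij, smul_zero]
      exact T.zero_mem
    · change (uE d i j * u) • hwVector d lam ∈ T
      rw [mul_smul]
      obtain ⟨y, hy, z, hz, hyz⟩ := Submodule.mem_sup.1 (show u • hwVector d lam ∈ T from hu)
      obtain ⟨c, rfl⟩ := Submodule.mem_span_singleton.1 hy
      rw [← hyz, smul_add, smul_comm]
      refine T.add_mem (T.smul_mem c ?_)
        (Submodule.mem_sup_right (uE_smul_mem_lowerPart hij hz))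
      rcases hij.eq_or_lt with rfl | hij
      · rw [uE_self_smul_hwVector]
        exact T.smul_mem _ hv
      · exact Submodule.mem_sup_right (uE_smul_hwVector_mem_lowerPart lam hij)
  rw [eq_top_iff]
  intro x _
  obtain ⟨u, rfl⟩ := exists_smul_hwVector x
  have : u ∈ Z := hZ ▸ Submodule.mem_top
  exact this

theorem hwVector_notMem_lowerPart {d : ℕ} {lam : Fin d → ℂ} (hv : hwVector d lam ≠ 0) :
    hwVector d lam ∉ lowerPart d lam := by
  intro hmem
  have hind := Module.End.eigenspaces_iSupIndep (actU (lam := lam) (gradingElement d))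
  refine hv (Submodule.disjoint_def.1 (hind (hwGrade lam)) _
    (Module.End.mem_eigenspace_iff.2 (gradingElement_smul_hwVector lam)) ?_)
  refine (iSup_le fun n => ?_ : lowerPart d lam ≤ _) hmem
  refine le_iSup₂_of_le (hwGrade lam - (n + 1)) (fun h => ?_) le_rfl
  have h0 : ((n : ℂ) + 1) = 0 := by linear_combination -h
  exact Nat.cast_add_one_ne_zero n h0

/-- The projection to the highest weight line is a functional that is invariant under the strictly
lower triangular matrices. -/
theorem exists_lowest_functional {d : ℕ} {lam : Fin d → ℂ} (hv : hwVector d lam ≠ 0) :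
    ∃ f : IrrepGl d lam →ₗ[ℂ] ℂ, f (hwVector d lam) ≠ 0 ∧
      (∀ i j, j < i → ∀ x, f (uE d i j • x) = 0) ∧
      ∀ i x, f (uE d i i • x) = lam i * f x := by
  obtain ⟨f, hf, hker⟩ := Submodule.exists_le_ker_of_notMem (hwVector_notMem_lowerPart hv)
  have hdec : ∀ x : IrrepGl d lam, ∃ c : ℂ, ∃ z ∈ lowerPart d lam,
      x = c • hwVector d lam + z := by
    intro x
    have hx : x ∈ Submodule.span ℂ {hwVector d lam} ⊔ lowerPart d lam :=
      span_hwVector_sup_lowerPart d lam ▸ Submodule.mem_top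
    obtain ⟨y, hy, z, hz, hyz⟩ := Submodule.mem_sup.1 hx
    obtain ⟨c, rfl⟩ := Submodule.mem_span_singleton.1 hy
    exact ⟨c, z, hz, hyz.symm⟩
  refine ⟨f, hf, fun i j hij x => ?_, fun i x => ?_⟩
  · obtain ⟨c, z, hz, rfl⟩ := hdec x
    rw [smul_add, smul_comm]
    exact hker (Submodule.add_mem _
      (Submodule.smul_mem _ c (uE_smul_hwVector_mem_lowerPart lam hij))
      (uE_smul_mem_lowerPart hij.le hz))
  · obtain ⟨c, z, hz, rfl⟩ := hdec x
    have h1 : f z = 0 := hker hz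
    have h2 : f (uE d i i • z) = 0 := hker (uE_smul_mem_lowerPart le_rfl hz)
    rw [smul_add, smul_comm, uE_self_smul_hwVector, map_add, map_add, h1, h2]
    simp only [map_smul, smul_eq_mul, add_zero]
    ring

/-! ### Highest weight vectors in tensor products -/

section Contraction

variable {L M : Type*} [AddCommGroup L] [Module ℂ L] [AddCommGroup M] [Module ℂ M]

/-- Contraction of the first tensor factor with a functional. -/
noncomputable def contractFst (g : L →ₗ[ℂ] ℂ) : L ⊗[ℂ] M →ₗ[ℂ] M :=
  (TensorProduct.lid ℂ M).toLinearMap ∘ₗ g.rTensor M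

theorem contractFst_tmul (g : L →ₗ[ℂ] ℂ) (x : L) (y : M) :
    contractFst g (x ⊗ₜ[ℂ] y) = g x • y := by
  simp [contractFst]

theorem contractFst_comb (c : ℂ) (g g' : L →ₗ[ℂ] ℂ) (w : L ⊗[ℂ] M) :
    contractFst (c • g + g') w = c • contractFst g w + contractFst g' w := by
  simp [contractFst, LinearMap.rTensor_add, LinearMap.rTensor_smul]

/-- A tensor vanishes if its contractions with a point-separating family of functionals do. -/
theorem eq_zero_of_contractFst_eq_zero (F : Set (L →ₗ[ℂ] ℂ))
    (hF : ∀ x, (∀ g ∈ F, g x = 0) → x = 0) (w : L ⊗[ℂ] M)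
    (hw : ∀ g ∈ F, contractFst g w = 0) : w = 0 := by
  let B := Module.Basis.ofVectorSpace ℂ M
  obtain ⟨b, rfl⟩ := TensorProduct.eq_repr_basis_right B w
  suffices h : ∀ i, b i = 0 by
    simp [Finsupp.sum, h]
  intro i
  refine hF _ fun g hg => ?_
  have h := hw g hg
  rw [Finsupp.sum, map_sum] at h
  simp only [contractFst_tmul] at h
  by_cases hi : i ∈ b.support
  · exact linearIndependent_iff'.1 B.linearIndependent b.support (fun i => g (b i)) h i hi
  · rw [Finsupp.notMem_support_iff.1 hi, map_zero]

end Contraction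

theorem contractFst_lie {d : ℕ} {lam : Fin d → ℂ} {M : Type*} [AddCommGroup M] [Module ℂ M]
    [LieRingModule (Gl d) M] [LieModule ℂ (Gl d) M] (g : IrrepGl d lam →ₗ[ℂ] ℂ) (X : Gl d)
    (w : IrrepGl d lam ⊗[ℂ] M) :
    contractFst g ⁅X, w⁆ =
      contractFst (g ∘ₗ actU (UniversalEnvelopingAlgebra.ι ℂ X)) w + ⁅X, contractFst g w⁆ := by
  induction w with
  | zero => simp
  | tmul x y =>
    rw [TensorProduct.LieModule.lie_tmul_right, map_add, contractFst_tmul, contractFst_tmul,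
      contractFst_tmul, contractFst_tmul, lie_smul]
    rfl
  | add x y hx hy =>
    rw [lie_add, map_add, hx, hy, map_add, map_add, lie_add]
    abel

/-- A nonzero highest weight vector of weight `nu` in `V_d^lam ⊗ M` has a nonzero component along
the highest weight vector of `V_d^lam`, and so `nu - lam` is a weight of `M`. -/
theorem exists_weight_vector_of_tensor {d : ℕ} {lam nu : Fin d → ℂ} {M : Type*} [AddCommGroup M]
    [Module ℂ M] [LieRingModule (Gl d) M] [LieModule ℂ (Gl d) M] {w : IrrepGl d lam ⊗[ℂ] M}
    (hw : w ≠ 0) (hup : ∀ i j, i < j → ⁅(Matrix.single i j (1 : ℂ) : Gl d), w⁆ = 0)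
    (hdiag : ∀ i, ⁅(Matrix.single i i (1 : ℂ) : Gl d), w⁆ = nu i • w) :
    ∃ u : M, u ≠ 0 ∧ ∀ i, ⁅(Matrix.single i i (1 : ℂ) : Gl d), u⁆ = (nu i - lam i) • u := by
  have hv : hwVector d lam ≠ 0 := by
    intro hv
    have : Subsingleton (IrrepGl d lam) := subsingleton_of_forall_eq 0 fun x => by
      obtain ⟨u, rfl⟩ := exists_smul_hwVector x
      rw [hv, smul_zero]
    exact hw (eq_zero_of_contractFst_eq_zero ∅ (fun x _ => Subsingleton.elim _ _) w (by simp))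
  obtain ⟨f, hfv, hlow, hcartan⟩ := exists_lowest_functional hv
  refine ⟨contractFst f w, fun h0 => hw ?_, fun i => ?_⟩
  · -- moving `b⁺` across the contraction only rescales it, as `w` is a highest weight vector
    let Z : Submodule ℂ (UGl d) :=
      { carrier := {a | contractFst (f ∘ₗ actU a) w = 0}
        zero_mem' := by simp [contractFst]
        add_mem' := fun {a b} ha hb => by
          have := contractFst_comb 1 (f ∘ₗ actU a) (f ∘ₗ actU b) w
          rw [ha, hb, smul_zero, add_zero, one_smul, ← LinearMap.comp_add] at this
          simpa [actU] using this
        smul_mem' := fun c a ha => by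
          have := contractFst_comb c (f ∘ₗ actU a) 0 w
          rw [ha, smul_zero, zero_add, add_zero, ← LinearMap.comp_smul] at this
          simpa [actU, contractFst] using this }
    have hZ : Z = ⊤ := by
      refine UGl.eq_top_of_lower_mul_mem Z ?_ (fun i j hij u => ?_) (fun i j hij u hu => ?_)
      · change contractFst (f ∘ₗ actU 1) w = 0
        have : f ∘ₗ actU 1 = f := LinearMap.ext fun x => congrArg f (one_smul (UGl d) x)
        rw [this, h0]
      · change contractFst (f ∘ₗ actU (uE d i j * u)) w = 0
        have : f ∘ₗ actU (uE d i j * u) = 0 := LinearMap.ext fun x =>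
          (congrArg f (mul_smul (uE d i j) u x)).trans (hlow i j hij _)
        rw [this]
        simp [contractFst]
      · change contractFst (f ∘ₗ actU (u * uE d i j)) w = 0
        have hu' : contractFst (f ∘ₗ actU u) w = 0 := hu
        have h := contractFst_lie (f ∘ₗ actU u) (Matrix.single i j (1 : ℂ) : Gl d) w
        have hcomp : f ∘ₗ actU (u * uE d i j) = (f ∘ₗ actU u) ∘ₗ actU (uE d i j) :=
          LinearMap.ext fun x => congrArg f (mul_smul u (uE d i j) x)
        rw [hu', lie_zero, add_zero] at h
        rw [hcomp]
        refine h.symm.trans ?_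
        rcases hij.eq_or_lt with rfl | hij
        · rw [hdiag, map_smul, hu', smul_zero]
        · rw [hup i j hij, map_zero]
    refine eq_zero_of_contractFst_eq_zero {g | ∃ a : UGl d, g = f ∘ₗ actU a} (fun x hx => ?_) w ?_
    · -- the vectors killed by all translates of `f` form a proper submodule
      let N : Submodule (UGl d) (IrrepGl d lam) :=
        { carrier := {y | ∀ a : UGl d, f (a • y) = 0}
          zero_mem' := fun a => by rw [smul_zero, map_zero]
          add_mem' := fun {y z} hy hz a => by rw [smul_add, map_add, hy, hz, add_zero]
          smul_mem' := fun b y hy a => by rw [smul_smul]; exact hy _ }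
      have hN : N ≠ ⊤ := fun h => by
        have hvN : hwVector d lam ∈ N := h ▸ Submodule.mem_top
        exact hfv (by simpa using hvN 1)
      have hxN : x ∈ N := fun a => hx _ ⟨a, rfl⟩
      rw [IrrepGl.eq_bot_of_ne_top N hN] at hxN
      exact (Submodule.mem_bot _).1 hxN
    · rintro _ ⟨a, rfl⟩
      have : a ∈ Z := hZ ▸ Submodule.mem_top
      exact this
  · have h := contractFst_lie f (Matrix.single i i (1 : ℂ) : Gl d) w
    have hcomp : f ∘ₗ actU (UniversalEnvelopingAlgebra.ι ℂ (Matrix.single i i (1 : ℂ) : Gl d)) =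
        lam i • f + 0 := LinearMap.ext fun x =>
      (hcartan i x).trans (by simp)
    rw [hdiag, map_smul, hcomp, contractFst_comb] at h
    rw [sub_smul, h]
    simp [contractFst]

/-! ### Eigenvalues on a quotient of a concrete highest weight module -/

theorem aeval_smul_of_smul_eq {A M : Type*} [Ring A] [Algebra ℂ A] [AddCommGroup M] [Module ℂ M]
    [Module A M] [IsScalarTower ℂ A M] {e : A} {x : M} {c : ℂ} (h : e • x = c • x)
    (Q : Polynomial ℂ) : Polynomial.aeval e Q • x = Q.eval c • x := by
  have : SMulCommClass A ℂ M := IsScalarTower.to_smulCommClass'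
  induction Q using Polynomial.induction_on with
  | C a => simp
  | add p q hp hq => rw [map_add, add_smul, hp, hq, Polynomial.eval_add, add_smul]
  | monomial n a ih =>
    rw [pow_succ, ← mul_assoc, map_mul, mul_smul, Polynomial.aeval_X, h, smul_comm, ih,
      Polynomial.eval_mul_X, mul_smul, smul_comm]

/-- If `v` is a highest weight vector of weight `lam` in some module, then `V_d^lam` is a quotient
of the submodule generated by `v`: every `u` in `U(gl_d)` killing `v` kills the highest weight
vector of `V_d^lam`. -/
theorem smul_hwVector_eq_zero_of_model {d : ℕ} {lam : Fin d → ℂ} {V : Type*} [AddCommGroup V]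
    [Module ℂ V] (ρ : Gl d →ₗ⁅ℂ⁆ Module.End ℂ V) {v : V} (hv : v ≠ 0)
    (hup : ∀ i j, i < j → ρ (Matrix.single i j 1) v = 0)
    (hdiag : ∀ i, ρ (Matrix.single i i 1) v = lam i • v)
    {u : UGl d} (hu : UniversalEnvelopingAlgebra.lift ℂ ρ u v = 0) :
    u • hwVector d lam = 0 := by
  have hE : ∀ i j, UniversalEnvelopingAlgebra.lift ℂ ρ (uE d i j) v =
      ρ (Matrix.single i j 1) v := fun i j => by
    rw [uE, UniversalEnvelopingAlgebra.lift_ι_apply]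
  let K : Submodule (UGl d) (UGl d) :=
    { carrier := {a | UniversalEnvelopingAlgebra.lift ℂ ρ a v = 0}
      zero_mem' := by simp
      add_mem' := fun {a b} ha hb => by
        change UniversalEnvelopingAlgebra.lift ℂ ρ (a + b) v = 0
        rw [map_add, LinearMap.add_apply, ha, hb, add_zero]
      smul_mem' := fun b a ha => by
        change UniversalEnvelopingAlgebra.lift ℂ ρ (b * a) v = 0
        rw [map_mul, Module.End.mul_apply, ha, map_zero] }
  have hIK : vermaIdeal d lam ≤ K := by
    refine Submodule.span_le.2 ?_
    rintro _ (⟨i, j, hij, rfl⟩ | ⟨i, rfl⟩)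
    · exact (hE i j).trans (hup i j hij)
    · change UniversalEnvelopingAlgebra.lift ℂ ρ (uE d i i - algebraMap ℂ (UGl d) (lam i)) v = 0
      rw [map_sub, LinearMap.sub_apply, hE, hdiag, AlgHom.commutes, Module.algebraMap_end_apply,
        sub_self]
  have hK : K.map (vermaIdeal d lam).mkQ ≠ ⊤ := by
    intro h
    have h1 : (vermaIdeal d lam).mkQ 1 ∈ K.map (vermaIdeal d lam).mkQ := h ▸ Submodule.mem_top
    have h2 : (1 : UGl d) ∈ K := by
      rw [← Submodule.mem_comap, Submodule.comap_map_mkQ, sup_eq_right.2 hIK] at h1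
      exact h1
    have h3 : UniversalEnvelopingAlgebra.lift ℂ ρ 1 v = 0 := h2
    rw [map_one] at h3
    exact hv h3
  rw [← irrepMk_eq_smul]
  exact vermaToIrrep_eq_zero_of_mem hK (Submodule.mem_map_of_mem hu)

/-- Eigenvalues on `V_d^lam` are controlled by those on any module `V` containing a highest weight
vector of weight `lam`. Polynomials annihilating elements of `V` are used instead of eigenvectors,
because an eigenvector of the quotient `V_d^lam` need not lift to one in `V`. -/
theorem eigenvalue_mem_of_model {d : ℕ} {lam : Fin d → ℂ} {V : Type*} [AddCommGroup V]
    [Module ℂ V] (ρ : Gl d →ₗ⁅ℂ⁆ Module.End ℂ V) {v : V} (hv : v ≠ 0)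
    (hup : ∀ i j, i < j → ρ (Matrix.single i j 1) v = 0)
    (hdiag : ∀ i, ρ (Matrix.single i i 1) v = lam i • v) {Y : Gl d} {S : Set ℂ}
    (hS : ∀ p : V, ∃ Q : Polynomial ℂ, (∀ c, Q.eval c = 0 → c ∈ S) ∧
      Polynomial.aeval (ρ Y) Q p = 0)
    {x : IrrepGl d lam} (hx : x ≠ 0) {c : ℂ} (hc : ⁅Y, x⁆ = c • x) : c ∈ S := by
  obtain ⟨u, rfl⟩ := exists_smul_hwVector x
  obtain ⟨Q, hQ, hQp⟩ := hS (UniversalEnvelopingAlgebra.lift ℂ ρ u v)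
  refine hQ c ?_
  have hkill : UniversalEnvelopingAlgebra.lift ℂ ρ
      (Polynomial.aeval (UniversalEnvelopingAlgebra.ι ℂ Y) Q * u) v = 0 := by
    rw [map_mul, Module.End.mul_apply, ← Polynomial.aeval_algHom_apply,
      UniversalEnvelopingAlgebra.lift_ι_apply]
    exact hQp
  have h0 := smul_hwVector_eq_zero_of_model ρ hv hup hdiag hkill
  rw [mul_smul, aeval_smul_of_smul_eq hc] at h0
  exact (smul_eq_zero.1 h0).resolve_right hx

/-! ### The action of `gl_d` on polynomials in a `d × d` matrix of variables -/

/-- Polynomials in the variables `x_{jk}`, the entries of a generic `d × d` matrix. -/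
abbrev MatPoly (d : ℕ) : Type := MvPolynomial (Fin d × Fin d) ℂ

/-- The matrix `Y` acts as the derivation `x_{jk} ↦ ∑ i, Y_{ij} x_{ik}`; in particular `E_{ij}` acts
as the polarization operator replacing the `j`-th row of variables by the `i`-th. -/
noncomputable def polarization {d : ℕ} (Y : Gl d) : Derivation ℂ (MatPoly d) (MatPoly d) :=
  MvPolynomial.mkDerivation ℂ fun p => ∑ i, Y i p.1 • MvPolynomial.X (i, p.2)

theorem polarization_X {d : ℕ} (Y : Gl d) (j k : Fin d) :
    polarization Y (MvPolynomial.X (j, k)) = ∑ i, Y i j • MvPolynomial.X (i, k) := by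
  rw [polarization, MvPolynomial.mkDerivation_X]

theorem polarization_single_X {d : ℕ} (i j a k : Fin d) :
    polarization (Matrix.single i j 1) (MvPolynomial.X (a, k)) =
      if a = j then MvPolynomial.X (i, k) else 0 := by
  rw [polarization_X]
  simp only [Matrix.single_apply, ite_smul, one_smul, zero_smul]
  by_cases h : a = j
  · subst h
    simp
  · simp [h, Ne.symm h]

theorem polarization_lie {d : ℕ} (Y Z : Gl d) :
    polarization ⁅Y, Z⁆ = ⁅polarization Y, polarization Z⁆ := by
  have key : ∀ (A B : Gl d) (j k : Fin d),
      polarization A (polarization B (MvPolynomial.X (j, k))) =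
        ∑ l, (A * B) l j • (MvPolynomial.X (l, k) : MatPoly d) := by
    intro A B j k
    simp only [polarization_X, map_sum, Derivation.map_smul, Finset.smul_sum, smul_smul,
      Matrix.mul_apply, Finset.sum_smul]
    rw [Finset.sum_comm]
    simp only [mul_comm]
  refine MvPolynomial.derivation_ext fun p => ?_
  obtain ⟨j, k⟩ := p
  rw [Derivation.commutator_apply, key, key, polarization_X, LieRing.of_associative_ring_bracket,
    ← Finset.sum_sub_distrib]
  simp only [Matrix.sub_apply, sub_smul]

/-- The representation of `gl_d` on polynomials by polarization operators. -/
noncomputable def polarizationRep (d : ℕ) : Gl d →ₗ⁅ℂ⁆ Module.End ℂ (MatPoly d) where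
  toFun Y := (polarization Y : MatPoly d →ₗ[ℂ] MatPoly d)
  map_add' Y Z := by
    have h : polarization (Y + Z) = polarization Y + polarization Z :=
      MvPolynomial.derivation_ext fun p => by
        obtain ⟨j, k⟩ := p
        simp [polarization_X, add_smul, Finset.sum_add_distrib]
    rw [h]
    rfl
  map_smul' c Y := by
    have h : polarization (c • Y) = c • polarization Y :=
      MvPolynomial.derivation_ext fun p => by
        obtain ⟨j, k⟩ := p
        simp [polarization_X, mul_smul, Finset.smul_sum]
    rw [h]
    rfl
  map_lie' {Y Z} := by
    rw [polarization_lie, Derivation.commutator_coe_linear_map]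

theorem polarizationRep_apply {d : ℕ} (Y : Gl d) (p : MatPoly d) :
    polarizationRep d Y p = polarization Y p := rfl

theorem exists_nat_polarization_monomial {d : ℕ} (m : Fin d) (s : Fin d × Fin d →₀ ℕ) (a : ℂ) :
    ∃ n : ℕ, polarization (Matrix.single m m 1) (MvPolynomial.monomial s a) =
      (n : ℂ) • MvPolynomial.monomial s a := by
  refine ⟨s.sum fun p k => if p.1 = m then k else 0, ?_⟩
  have hgen : ∀ p : Fin d × Fin d,
      (∑ i, (Matrix.single m m (1 : ℂ) : Gl d) i p.1 • (MvPolynomial.X (i, p.2) : MatPoly d)) =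
        if p.1 = m then MvPolynomial.X p else 0 := by
    rintro ⟨j, k⟩
    rw [← polarization_X, polarization_single_X]
    split_ifs with h
    · rw [show j = m from h]
    · rfl
  rw [polarization, MvPolynomial.mkDerivation_monomial]
  simp only [hgen, Finsupp.sum, Nat.cast_sum, Finset.sum_smul, Finset.smul_sum]
  refine Finset.sum_congr rfl fun p hp => ?_
  by_cases h : p.1 = m
  · have hs : s - Finsupp.single p 1 + Finsupp.single p 1 = s :=
      tsub_add_cancel_of_le (Finsupp.single_le_iff.2
        (Nat.one_le_iff_ne_zero.2 (Finsupp.mem_support_iff.1 hp)))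
    rw [if_pos h, if_pos h, smul_eq_mul, MvPolynomial.X, MvPolynomial.monomial_mul, hs, mul_one,
      MvPolynomial.smul_monomial, MvPolynomial.smul_monomial, smul_eq_mul, smul_eq_mul, mul_comm]
  · simp [h]

theorem exists_annihilator_of_diagonal {σ : Type*} {T : Module.End ℂ (MvPolynomial σ ℂ)}
    {S : Set ℂ} (hT : ∀ s a, ∃ c ∈ S, T (MvPolynomial.monomial s a) =
      c • MvPolynomial.monomial s a) (p : MvPolynomial σ ℂ) :
    ∃ Q : Polynomial ℂ, (∀ c, Q.eval c = 0 → c ∈ S) ∧ Polynomial.aeval T Q p = 0 := by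
  have hmon : ∀ s a, ∃ Q : Polynomial ℂ, (∀ c, Q.eval c = 0 → c ∈ S) ∧
      Polynomial.aeval T Q (MvPolynomial.monomial s a) = 0 := by
    intro s a
    obtain ⟨c, hc, h⟩ := hT s a
    refine ⟨Polynomial.X - Polynomial.C c, fun b hb => ?_, ?_⟩
    · rw [Polynomial.eval_sub, Polynomial.eval_X, Polynomial.eval_C, sub_eq_zero] at hb
      exact hb ▸ hc
    · simp [h]
  induction p using MvPolynomial.induction_on' with
  | monomial s a => exact hmon s a
  | add p q hp hq =>
    obtain ⟨P, hP, hPp⟩ := hp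
    obtain ⟨Q, hQ, hQq⟩ := hq
    refine ⟨P * Q, fun c hc => ?_, ?_⟩
    · rw [Polynomial.eval_mul] at hc
      exact (mul_eq_zero.1 hc).elim (hP c) (hQ c)
    · have h1 : Polynomial.aeval T (P * Q) p = 0 := by
        rw [mul_comm, map_mul, Module.End.mul_apply, hPp, map_zero]
      have h2 : Polynomial.aeval T (P * Q) q = 0 := by
        rw [map_mul, Module.End.mul_apply, hQq, map_zero]
      rw [map_add, h1, h2, add_zero]

/-! ### Highest weight vectors: products of leading principal minors -/

theorem Derivation.map_prod_eq_sum {A ι : Type*} [CommRing A] [Algebra ℂ A] [DecidableEq ι]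
    (D : Derivation ℂ A A) (s : Finset ι) (f : ι → A) :
    D (∏ i ∈ s, f i) = ∑ i ∈ s, D (f i) * ∏ j ∈ s.erase i, f j := by
  induction s using Finset.induction_on with
  | empty => simp
  | insert a s ha ih =>
    rw [Finset.prod_insert ha, D.leibniz, ih, Finset.sum_insert ha, Finset.erase_insert ha,
      smul_eq_mul, smul_eq_mul, Finset.mul_sum, add_comm, mul_comm]
    congr 1
    refine Finset.sum_congr rfl fun i hi => ?_
    have hia : a ≠ i := fun h => ha (h ▸ hi)
    rw [Finset.erase_insert_of_ne hia, Finset.prod_insert fun h => ha (Finset.mem_of_mem_erase h)]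
    ring

theorem Derivation.map_det_eq_sum_updateCol {A n : Type*} [CommRing A] [Algebra ℂ A] [Fintype n]
    [DecidableEq n] (D : Derivation ℂ A A) (N : Matrix n n A) :
    D N.det = ∑ c, (N.updateCol c fun r => D (N r c)).det := by
  simp only [Matrix.det_apply, map_sum]
  rw [Finset.sum_comm]
  refine Finset.sum_congr rfl fun σ _ => ?_
  rw [Units.smul_def, map_zsmul, Derivation.map_prod_eq_sum, Finset.smul_sum]
  refine Finset.sum_congr rfl fun c _ => ?_
  rw [Units.smul_def, ← Finset.mul_prod_erase Finset.univ _ (Finset.mem_univ c),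
    Matrix.updateCol_self]
  congr 2
  refine Finset.prod_congr rfl fun i hi => ?_
  rw [Matrix.updateCol_ne (Finset.ne_of_mem_erase hi)]

theorem Derivation.map_prod_pow_of_eigen {A ι : Type*} [CommRing A] [Algebra ℂ A]
    (D : Derivation ℂ A A) (s : Finset ι) (f : ι → A) (c : ι → ℂ) (a : ι → ℕ)
    (h : ∀ i ∈ s, D (f i) = c i • f i) :
    D (∏ i ∈ s, f i ^ a i) = (∑ i ∈ s, a i * c i) • ∏ i ∈ s, f i ^ a i := by
  have hmul : ∀ {x y : A} {b e : ℂ}, D x = b • x → D y = e • y → D (x * y) = (b + e) • (x * y) := by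
    intro x y b e hx hy
    rw [D.leibniz, hx, hy, smul_eq_mul, smul_eq_mul, mul_smul_comm, mul_smul_comm, mul_comm y x,
      add_smul, add_comm]
  have hpow : ∀ {x : A} {b : ℂ} (n : ℕ), D x = b • x → D (x ^ n) = (n * b) • x ^ n := by
    intro x b n hx
    induction n with
    | zero => simp
    | succ n ih =>
      rw [pow_succ, hmul ih hx]
      push_cast
      congr 1
      ring
  classical
  induction s using Finset.induction_on with
  | empty => simp
  | insert i s hi ih =>
    rw [Finset.prod_insert hi, Finset.sum_insert hi]
    exact hmul (hpow _ (h i (Finset.mem_insert_self i s)))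
      (ih fun j hj => h j (Finset.mem_insert_of_mem hj))

/-- The (transposed) matrix of variables with the rows of index `> p` replaced by those of the
identity matrix, whose determinant is the leading principal minor of size `p + 1`. -/
noncomputable def truncatedGeneric {d : ℕ} (p : Fin d) : Matrix (Fin d) (Fin d) (MatPoly d) :=
  Matrix.of fun k i => if i ≤ p then MvPolynomial.X (i, k) else if k = i then 1 else 0

theorem det_truncatedGeneric_ne_zero {d : ℕ} (p : Fin d) : (truncatedGeneric p).det ≠ 0 := by
  intro h
  -- the minor takes the value `1` at the identity matrix
  let ev : MatPoly d →+* ℂ := MvPolynomial.eval fun q => if q.2 = q.1 then 1 else 0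
  have h1 : ev.mapMatrix (truncatedGeneric p) = 1 := by
    ext k i
    simp only [RingHom.mapMatrix_apply, Matrix.map_apply, truncatedGeneric, Matrix.of_apply,
      Matrix.one_apply]
    split_ifs <;> simp_all [ev]
  have h2 := congrArg ev h
  rw [RingHom.map_det, h1, Matrix.det_one, map_zero] at h2
  exact one_ne_zero h2

theorem polarization_single_det {d : ℕ} (p i j : Fin d) :
    polarization (Matrix.single i j 1) (truncatedGeneric p).det =
      if j ≤ p then ((truncatedGeneric p).updateCol j fun k => MvPolynomial.X (i, k)).det
      else 0 := by
  have hcol : ∀ c r, polarization (Matrix.single i j 1) (truncatedGeneric p r c) =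
      if c = j ∧ j ≤ p then MvPolynomial.X (i, r) else 0 := by
    intro c r
    simp only [truncatedGeneric, Matrix.of_apply]
    by_cases hc : c ≤ p
    · rw [if_pos hc, polarization_single_X]
      refine if_congr ⟨fun h => ⟨h, h ▸ hc⟩, fun h => h.1⟩ rfl rfl
    · have : ¬(c = j ∧ j ≤ p) := fun h => hc (h.1 ▸ h.2)
      rw [if_neg hc, if_neg this]
      split_ifs <;> simp
  rw [Derivation.map_det_eq_sum_updateCol]
  simp only [hcol]
  rw [Finset.sum_eq_single j]
  · by_cases hj : j ≤ p
    · simp [hj]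
    · simp only [hj, and_false, if_false]
      exact Matrix.det_eq_zero_of_column_eq_zero j fun k => by simp
  · intro c _ hc
    refine Matrix.det_eq_zero_of_column_eq_zero c fun k => ?_
    simp [hc]
  · exact fun h => absurd (Finset.mem_univ j) h

theorem polarization_single_det_of_lt {d : ℕ} (p : Fin d) {i j : Fin d} (hij : i < j) :
    polarization (Matrix.single i j 1) (truncatedGeneric p).det = 0 := by
  rw [polarization_single_det]
  split_ifs with hj
  · have : (fun k => (MvPolynomial.X (i, k) : MatPoly d)) = fun k => truncatedGeneric p k i := by
      funext k
      simp [truncatedGeneric, hij.le.trans hj]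
    rw [this]
    exact Matrix.det_updateCol_eq_zero hij.ne
  · rfl

theorem polarization_single_self_det {d : ℕ} (p i : Fin d) :
    polarization (Matrix.single i i 1) (truncatedGeneric p).det =
      (if i ≤ p then (1 : ℂ) else 0) • (truncatedGeneric p).det := by
  rw [polarization_single_det]
  split_ifs with hi
  · have : (fun k => (MvPolynomial.X (i, k) : MatPoly d)) = fun k => truncatedGeneric p k i := by
      funext k
      simp [truncatedGeneric, hi]
    rw [this, one_smul]
    congr 1
    exact Matrix.updateCol_eq_self _ _
  · rw [zero_smul]

/-- A partition is a sum of the fundamental weights `(1, …, 1, 0, …, 0)`. -/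
theorem IsPartition.exists_eq_sum {d : ℕ} {lam : Fin d → ℤ} (hlam : IsPartition lam) :
    ∃ a : Fin d → ℕ, ∀ i, ∑ p, (if i ≤ p then (a p : ℤ) else 0) = lam i := by
  let ℓ : ℕ → ℤ := fun n => if h : n < d then lam ⟨n, h⟩ else 0
  have hℓ : ∀ n, 0 ≤ ℓ n - ℓ (n + 1) := by
    intro n
    simp only [ℓ]
    split_ifs with h1 h2 h2
    · exact sub_nonneg.2 (hlam.1 (Fin.mk_le_mk.2 n.le_succ))
    · rw [sub_zero]
      exact hlam.2 _
    · omega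
    · simp
  refine ⟨fun p => (ℓ p - ℓ (p + 1)).toNat, fun i => ?_⟩
  -- the truncated sum telescopes once the indices below `i` are replaced by `i`
  have hterm : ∀ p : Fin d, (if i ≤ p then (((ℓ p - ℓ (p + 1)).toNat : ℕ) : ℤ) else 0) =
      ℓ (max i p) - ℓ (max i (p + 1)) := by
    intro p
    rw [Int.toNat_of_nonneg (hℓ p)]
    split_ifs with h
    · have h' : (i : ℕ) ≤ p := h
      rw [max_eq_right h', max_eq_right (h'.trans (Nat.le_succ _))]
    · have h' : (p : ℕ) < i := not_le.1 h
      rw [max_eq_left h'.le, max_eq_left (Nat.succ_le_of_lt h'), sub_self]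
  simp only [hterm]
  rw [Fin.sum_univ_eq_sum_range (fun n => ℓ (max i n) - ℓ (max i (n + 1))),
    Finset.sum_range_sub' (fun n => ℓ (max i n))]
  have h0 : ℓ (max i d) = 0 := by simp [ℓ]
  have h1 : ℓ (max i 0) = lam i := by simp [ℓ]
  rw [h0, h1, sub_zero]

theorem IsPartition.exists_highest_weight_polynomial {d : ℕ} {lam : Fin d → ℤ}
    (hlam : IsPartition lam) : ∃ v : MatPoly d, v ≠ 0 ∧
      (∀ i j, i < j → polarizationRep d (Matrix.single i j 1) v = 0) ∧
      ∀ i, polarizationRep d (Matrix.single i i 1) v = (lam i : ℂ) • v := by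
  obtain ⟨a, ha⟩ := hlam.exists_eq_sum
  refine ⟨∏ p, (truncatedGeneric p).det ^ a p, Finset.prod_ne_zero_iff.2 fun p _ =>
    pow_ne_zero _ (det_truncatedGeneric_ne_zero p), fun i j hij => ?_, fun i => ?_⟩
  · rw [polarizationRep_apply, Derivation.map_prod_pow_of_eigen _ _ _ (fun _ => 0) a
      (fun p _ => by rw [polarization_single_det_of_lt p hij, zero_smul])]
    simp
  · rw [polarizationRep_apply, Derivation.map_prod_pow_of_eigen _ _ _ _ a
      (fun p _ => polarization_single_self_det p i), ← ha i]
    congr 1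
    push_cast
    refine Finset.sum_congr rfl fun p _ => ?_
    split_ifs <;> simp

/-- The weights of `V_d^lam`, for a partition `lam`, have non-negative integer entries. -/
theorem IsPartition.eigenvalue_mem_nat {d : ℕ} {lam : Fin d → ℤ} (hlam : IsPartition lam)
    (m : Fin d) {x : IrrepGl d fun i => (lam i : ℂ)} (hx : x ≠ 0) {c : ℂ}
    (hc : ⁅(Matrix.single m m (1 : ℂ) : Gl d), x⁆ = c • x) : ∃ n : ℕ, c = n := by
  obtain ⟨v, hv, hup, hdiag⟩ := hlam.exists_highest_weight_polynomial
  refine eigenvalue_mem_of_model (S := {c | ∃ n : ℕ, c = n}) (polarizationRep d) hv hup hdiag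
    (fun p => exists_annihilator_of_diagonal (fun s a => ?_) p) hx hc
  obtain ⟨n, hn⟩ := exists_nat_polarization_monomial m s a
  exact ⟨n, ⟨n, rfl⟩, hn⟩

/-- The automorphism `E_{ij} ↦ -E_{d+1-j, d+1-i}` of `gl_d`. It preserves the upper triangular
Borel subalgebra, and twisting by it turns the highest weight `mu` into `-mu` reversed. -/
def revNegTranspose (d : ℕ) : Gl d →ₗ⁅ℂ⁆ Gl d where
  toFun Y := -(Y.submatrix Fin.rev Fin.rev).transpose
  map_add' Y Z := by
    ext i j
    simp [add_comm]
  map_smul' c Y := by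
    ext i j
    simp
  map_lie' {Y Z} := by
    have hsub : ∀ A B : Gl d, (A * B).submatrix Fin.rev Fin.rev =
        A.submatrix Fin.rev Fin.rev * B.submatrix Fin.rev Fin.rev := fun A B =>
      (Matrix.submatrix_mul_equiv A B Fin.rev Fin.revPerm Fin.rev).symm
    simp only [LieRing.of_associative_ring_bracket, Matrix.submatrix_sub, Pi.sub_apply, hsub,
      Matrix.transpose_sub, Matrix.transpose_mul, neg_mul_neg]
    abel

theorem revNegTranspose_single {d : ℕ} (i j : Fin d) :
    revNegTranspose d (Matrix.single i j 1) = -Matrix.single j.rev i.rev 1 := by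
  have h := Matrix.submatrix_single_equiv Fin.revPerm Fin.revPerm i j (1 : ℂ)
  change -((Matrix.single i j (1 : ℂ)).submatrix Fin.revPerm Fin.revPerm).transpose = _
  rw [h, Matrix.transpose_single]
  rfl

theorem IsNonposGeneralizedPartition.isPartition_neg_rev {d : ℕ} {mu : Fin d → ℤ}
    (hmu : IsNonposGeneralizedPartition mu) : IsPartition fun i => -mu i.rev :=
  ⟨fun _ _ h => neg_le_neg (hmu.1 (Fin.rev_le_rev.2 h)), fun _ => neg_nonneg.2 (hmu.2 _)⟩

/-- The weights of `V_d^mu`, for non-positive `mu`, have non-positive integer entries. -/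
theorem IsNonposGeneralizedPartition.eigenvalue_mem_neg_nat {d : ℕ} {mu : Fin d → ℤ}
    (hmu : IsNonposGeneralizedPartition mu) (m : Fin d) {x : IrrepGl d fun i => (mu i : ℂ)}
    (hx : x ≠ 0) {c : ℂ} (hc : ⁅(Matrix.single m m (1 : ℂ) : Gl d), x⁆ = c • x) :
    ∃ n : ℕ, c = -n := by
  obtain ⟨v, hv, hup, hdiag⟩ := hmu.isPartition_neg_rev.exists_highest_weight_polynomial
  have hρ : ∀ i j p, (polarizationRep d).comp (revNegTranspose d) (Matrix.single i j 1) p =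
      -polarizationRep d (Matrix.single j.rev i.rev 1) p := fun i j p => by
    rw [LieHom.comp_apply, revNegTranspose_single, map_neg, LinearMap.neg_apply]
  refine eigenvalue_mem_of_model (S := {c | ∃ n : ℕ, c = -n})
    ((polarizationRep d).comp (revNegTranspose d)) hv (fun i j hij => ?_) (fun i => ?_)
    (fun p => exists_annihilator_of_diagonal (fun s a => ?_) p) hx hc
  · rw [hρ, hup _ _ (Fin.rev_lt_rev.2 hij), neg_zero]
  · rw [hρ, hdiag, Fin.rev_rev, Int.cast_neg, neg_smul, neg_neg]
  · obtain ⟨n, hn⟩ := exists_nat_polarization_monomial m.rev s a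
    refine ⟨-n, ⟨n, rfl⟩, ?_⟩
    rw [hρ, polarizationRep_apply, hn, neg_smul]

/-! ### Homomorphisms into the tensor product -/

theorem IrrepGl.eq_zero_of_map_hwVector_eq_zero {d : ℕ} {nu : Fin d → ℂ} {M : Type*}
    [AddCommGroup M] [Module ℂ M] [LieRingModule (Gl d) M]
    (φ : IrrepGl d nu →ₗ⁅ℂ, Gl d⁆ M) (h : φ (hwVector d nu) = 0) : φ = 0 := by
  let Z : Submodule ℂ (UGl d) :=
    { carrier := {u | φ (u • hwVector d nu) = 0}
      zero_mem' := by
        change φ ((0 : UGl d) • hwVector d nu) = 0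
        rw [zero_smul, map_zero]
      add_mem' := fun {a b} ha hb => by
        change φ ((a + b) • hwVector d nu) = 0
        rw [add_smul, map_add, ha, hb, add_zero]
      smul_mem' := fun c a ha => by
        change φ ((c • a) • hwVector d nu) = 0
        rw [smul_assoc, map_smul, ha, smul_zero] }
  have hZ : Z = ⊤ := by
    refine UGl.eq_top_of_mul_left_mem Z ?_ fun i j u hu => ?_
    · change φ ((1 : UGl d) • hwVector d nu) = 0
      rwa [one_smul]
    · change φ ((uE d i j * u) • hwVector d nu) = 0
      have hu' : φ (u • hwVector d nu) = 0 := hu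
      have := LieModuleHom.map_lie φ (Matrix.single i j (1 : ℂ) : Gl d) (u • hwVector d nu)
      rw [hu', lie_zero] at this
      rw [mul_smul]
      exact this
  ext x
  obtain ⟨u, rfl⟩ := exists_smul_hwVector x
  have : u ∈ Z := hZ ▸ Submodule.mem_top
  exact this

theorem comm_lie {d : ℕ} {L M : Type*} [AddCommGroup L] [Module ℂ L] [LieRingModule (Gl d) L]
    [LieModule ℂ (Gl d) L] [AddCommGroup M] [Module ℂ M] [LieRingModule (Gl d) M]
    [LieModule ℂ (Gl d) M] (X : Gl d) (w : L ⊗[ℂ] M) :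
    TensorProduct.comm ℂ L M ⁅X, w⁆ = ⁅X, TensorProduct.comm ℂ L M w⁆ := by
  induction w with
  | zero => simp
  | tmul x y =>
    rw [TensorProduct.LieModule.lie_tmul_right, map_add, TensorProduct.comm_tmul,
      TensorProduct.comm_tmul, TensorProduct.comm_tmul, TensorProduct.LieModule.lie_tmul_right,
      add_comm]
  | add x y hx hy => rw [lie_add, map_add, hx, hy, map_add, lie_add]

theorem weight_bounds_of_highest_weight_vector {d : ℕ} {lam mu nu : Fin d → ℤ}
    (hlam : IsPartition lam) (hmu : IsNonposGeneralizedPartition mu)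
    {w : IrrepGl d (fun i => (lam i : ℂ)) ⊗[ℂ] IrrepGl d (fun i => (mu i : ℂ))} (hw : w ≠ 0)
    (hup : ∀ i j, i < j → ⁅(Matrix.single i j (1 : ℂ) : Gl d), w⁆ = 0)
    (hdiag : ∀ i, ⁅(Matrix.single i i (1 : ℂ) : Gl d), w⁆ = (nu i : ℂ) • w) (m : Fin d) :
    mu m ≤ nu m ∧ nu m ≤ lam m := by
  constructor
  · obtain ⟨u, hu, hwt⟩ := exists_weight_vector_of_tensor
      (w := TensorProduct.comm ℂ _ _ w) (nu := fun i => (nu i : ℂ))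
      (by simpa using hw) (fun i j hij => by rw [← comm_lie, hup i j hij, map_zero])
      (fun i => by rw [← comm_lie, hdiag, map_smul])
    obtain ⟨n, hn⟩ := hlam.eigenvalue_mem_nat m hu (hwt m)
    have : nu m - mu m = n := by exact_mod_cast hn
    omega
  · obtain ⟨u, hu, hwt⟩ := exists_weight_vector_of_tensor (nu := fun i => (nu i : ℂ)) hw hup hdiag
    obtain ⟨n, hn⟩ := hmu.eigenvalue_mem_neg_nat m hu (hwt m)
    have : nu m - lam m = -n := by exact_mod_cast hn
    omega

theorem mainTheorem10 (d : ℕ) (lam mu nu : Fin d → ℤ)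
    (hlam : IsPartition lam) (hmu : IsNonposGeneralizedPartition mu)
    (hnu : IsGeneralizedPartition nu)
    (h : ∃ m : Fin d, lam m < nu m ∨ nu m < mu m) :
    lrCoeff d lam mu nu = 0 := by
  have hzero : ∀ φ : IrrepGl d (fun i => (nu i : ℂ)) →ₗ⁅ℂ, Gl d⁆
      (IrrepGl d (fun i => (lam i : ℂ)) ⊗[ℂ] IrrepGl d (fun i => (mu i : ℂ))), φ = 0 := by
    intro φ
    by_contra hφ
    obtain ⟨m, hm⟩ := h
    have hb := weight_bounds_of_highest_weight_vector (nu := nu) hlam hmu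
      (fun h0 => hφ (IrrepGl.eq_zero_of_map_hwVector_eq_zero φ h0))
      (fun i j hij => by
        rw [← LieModuleHom.map_lie]
        exact (congrArg φ (uE_smul_hwVector_of_lt _ hij)).trans (map_zero φ))
      (fun i => by
        rw [← LieModuleHom.map_lie]
        exact (congrArg φ (uE_self_smul_hwVector _ i)).trans (map_smul φ _ _)) m
    omega
  rw [lrCoeff, rank_eq_zero_iff.2 fun φ => ⟨1, one_ne_zero, by rw [hzero φ, smul_zero]⟩, map_zero]
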